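/- Let $0<\beta<1$ and consider a binary-input memoryless channel that erases each transmitted bit independently with probability $\beta$ and otherwise delivers it correctly, with noiseless output feedback of unit delay. A message stream of rate $R\ge 0$ is an arbitrary sequence of bits, of which the $j$-th arrives at time $j/R$, so that $\lfloor tR\rfloor$ bits have arrived by time $t$. A sequential communication system for one or several streams consists of encoders, which choose the channel input at time $t$ from the first $t-1$ channel outputs and the message bits that have arrived by time $t$, and decoders, which at each time $t$ estimate all message bits that have arrived by time $t$ from the first $t$ channel outputs. A stream has \emph{anytime reliability} $\alpha$ if there is a constant $K$ such that, for all times $t$, all delays $0\le d\le t$ and all message sequences, the probability that at time $t$ the estimate of the first $\lfloor (t-d)R\rfloor$ bits of this stream is not entirely correct is less than $K2^{-\alpha d}$. The feedback anytime capacity $C_{\rm any}(\alpha)$ is the supremum of the rates $R\ge 0$ for which some single-stream system has anytime reliability $\alpha$. The strict two-priority scheme serves a high-priority stream of rate $R_H$ and a low-priority stream of rate $R_L$. Each stream has a FIFO buffer; at every channel use the oldest bit of the nonempty buffer of highest priority is sent (a dummy bit if both buffers are empty), and it is removed from its buffer if it is received. The decoder outputs the received bits, and any guesses for the bits not received yet.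 Let $0<R_H<1-\beta$. Put $E_0(\rho)=-\log_2\left(\beta+2^{-\rho}(1-\beta)\right)$ and $D(p\|q)=p\log_2\frac pq+(1-p)\log_2\frac{1-p}{1-q}$. Then there is exactly one $\alpha_H$ with $C_{\rm any}(\alpha_H)=R_H$, that is, $\alpha_H=C_{\rm any}^{-1}(R_H)$ is well defined. For every $R_L$ with $0\le R_L<1-\beta-R_H$: 1. the largest anytime reliability that the scheme attains for the high-priority stream is $\alpha_H$; 2. the equation $R_H+R_L=E_0(\rho)/\rho$ has a unique solution $\rho_{HL}$, it is positive, and the scheme attains for the low-priority stream the anytime reliability $\max_{\rho\le\rho_{HL}}\left[E_0(\rho)-\rho R_H\right]$ (this maximum exists), so that its reliability is at least this number. Moreover, there is $\delta>0$, depending only on $\beta$ and $R_H$, such that for all such $R_L<\delta$ the maximum in 2 equals the sphere-packing bound $D(1-R_H\|\beta)$. -/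

import Mathlib

open MeasureTheory ProbabilityTheory

namespace Anytime

/-! ### The binary erasure channel

Channel uses are numbered `k = 0, 1, 2, …`; use `k` happens at time `k + 1`, so that exactly
`t` uses have happened by time `t`. A channel output is an `Option Bool`: `none` is an erasure,
`some b` a correctly received bit `b`. -/

/-- The erasure pattern: the uses are erased (`true`) independently with probability `β`. -/
noncomputable def erasureMeasure (β : unitInterval) : Measure (ℕ → Bool) :=
  Measure.infinitePi fun _ : ℕ => bernoulliMeasure true false β

/-- The output of the channel for the input `a`, given whether this use is erased. -/
def erase (erased : Bool) (a : Bool) : Option Bool :=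
  if erased then none else some a

/-! ### Sequential communication systems with feedback -/

/-- The number of bits of a rate `R` stream that have arrived by time `t`: the `j`-th bit
(`j = 1, 2, …`) arrives at time `j / R`. -/
noncomputable def arrived (R : ℝ) (t : ℕ) : ℕ := ⌊(t : ℝ) * R⌋₊

/-- A sequential communication system for message streams indexed by `ι` with rates `R i`, over
a channel with binary input and outputs in `Option Bool`, with noiseless output feedback of unit
delay. At time `k + 1` the encoder knows the `k` past channel outputs and the message bits that
have arrived by then. At every time `t` the decoder estimates all the message bits that have
arrived by then from the `t` channel outputs so far. Bits are numbered from `0`. -/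
structure System {ι : Type} (R : ι → ℝ) where
  enc : (k : ℕ) → (Fin k → Option Bool) → ((i : ι) → Fin (arrived (R i) (k + 1)) → Bool) → Bool
  dec : (t : ℕ) → (Fin t → Option Bool) → (i : ι) → Fin (arrived (R i) t) → Bool

namespace System

variable {ι : Type} {R : ι → ℝ}

/-- The first `t` channel outputs, for the message bits `S` and the erasure pattern `ω`. -/
def outputs (sys : System R) (S : ι → ℕ → Bool) (ω : ℕ → Bool) : (t : ℕ) → Fin t → Option Bool
  | 0 => Fin.elim0
  | k + 1 =>
    Fin.snoc (α := fun _ => Option Bool) (sys.outputs S ω k)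
      (erase (ω k) (sys.enc k (sys.outputs S ω k) fun i j => S i j))

/-- The event that at time `t` the estimate of the bits of stream `i` that arrived by time
`t - d` is not entirely correct. -/
def errorEvent (sys : System R) (S : ι → ℕ → Bool) (i : ι) (t d : ℕ) : Set (ℕ → Bool) :=
  {ω | ∃ j : Fin (arrived (R i) t),
    (j : ℕ) < arrived (R i) (t - d) ∧ sys.dec t (sys.outputs S ω t) i j ≠ S i j}

/-- Stream `i` has anytime reliability `α` (in bits per unit of delay) over the binary erasure
channel with erasure probability `β`: the probability of error decays like `K 2 ^ (-α d)` in the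
delay `d`, uniformly in the time and in the messages. -/
def Attains (sys : System R) (β : unitInterval) (i : ι) (α : ℝ) : Prop :=
  ∃ K : ℝ, ∀ (S : ι → ℕ → Bool) (t d : ℕ), d ≤ t →
    (erasureMeasure β).real (sys.errorEvent S i t d) < K * (2 : ℝ) ^ (-(α * d))

end System

/-- The feedback anytime capacity of the binary erasure channel: the supremum of the rates at
which some single-stream system with feedback has anytime reliability `α`. -/
noncomputable def anytimeCapacity (β : unitInterval) (α : ℝ) : EReal :=
  sSup {r : EReal | ∃ R : ℝ, r = (R : EReal) ∧ 0 ≤ R ∧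
    ∃ sys : System (fun _ : Unit => R), sys.Attains β () α}

/-! ### The strict two-priority scheme -/

/-- The two message streams. -/
inductive Stream
  | high
  | low
  deriving DecidableEq

/-- The rates of the two streams. -/
def rates (RH RL : ℝ) : Stream → ℝ
  | .high => RH
  | .low => RL

/-- The stream served at use `k` (time `k + 1`) if `n p` bits of each stream `p` have been
removed from its buffer so far: the high-priority one if its buffer is not empty, else the
low-priority one if its buffer is not empty, else none. -/
noncomputable def served (R : Stream → ℝ) (k : ℕ) (n : Stream → ℕ) : Option Stream :=
  if n .high < arrived (R .high) (k + 1) then some .high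
  else if n .low < arrived (R .low) (k + 1) then some .low
  else none

/-- The bits of each stream that have been received (and hence have been removed from its
buffer), in their order, as a function of the channel outputs alone: both ends know the
arrival times, and so which stream each use belongs to. -/
noncomputable def received (R : Stream → ℝ) :
    (t : ℕ) → (Fin t → Option Bool) → Stream → List Bool
  | 0, _ => fun _ => []
  | k + 1, z =>
    let r := received R k (Fin.init z)
    match served R k (fun p => (r p).length), z (Fin.last k) with
    | some p, some b => Function.update r p (r p ++ [b])
    | _, _ => r

/-- The strict two-priority FIFO retransmission scheme. The encoder sends the oldest bit of the
nonempty buffer of highest priority (a dummy bit if both buffers are empty); a bit leaves its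
buffer when it gets through. The decoder outputs the bits that it received and an arbitrary
`guess`, which may depend on everything it has seen, for the bits still missing. -/
noncomputable def priorityScheme (RH RL : ℝ)
    (guess : (t : ℕ) → (Fin t → Option Bool) → Stream → ℕ → Bool) : System (rates RH RL) where
  enc k z m :=
    let n : Stream → ℕ := fun p => (received (rates RH RL) k z p).length
    match served (rates RH RL) k n with
    | some p => if h : n p < arrived (rates RH RL p) (k + 1) then m p ⟨n p, h⟩ else false
    | none => false
  dec t z p j := ((received (rates RH RL) t z p)[(j : ℕ)]?).getD (guess t z p j)

/-! ### Exponents -/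

/-- The base-2 Gallager function of the binary erasure channel. -/
noncomputable def gallagerE0 (β ρ : ℝ) : ℝ :=
  -Real.logb 2 (β + (2 : ℝ) ^ (-ρ) * (1 - β))

/-- The Kullback-Leibler divergence `D(p‖q)` in bits between Bernoulli laws, `0 < p, q < 1`. -/
noncomputable def binaryDiv (p q : ℝ) : ℝ :=
  p * Real.logb 2 (p / q) + (1 - p) * Real.logb 2 ((1 - p) / (1 - q))

end Anytime

namespace Anytime

/-! ### The Gallager function of the erasure channel -/

section Exponents

variable {b : ℝ}

/-! One channel use multiplies the mean of `2 ^ (-ρ * successes)` by `2 ^ (-E₀(ρ))`; both directions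
rest on this factor.

Achievability is Lundberg's inequality (`tail_queue`): for `0 ≤ ρ` with `ρ R ≤ E₀(ρ)`, a queue of
rate `R` has a backlog whose tail decays like `2 ^ (-ρ y)`, since the arrivals of one step cost at
most what one use gains. The high-priority buffer sees the channel alone, which gives the exponent
`ρ R_H`, equal to `E₀(ρ)` when `R_H = E₀(ρ) / ρ`. For the low-priority stream, no use is idle while
an old bit waits, so the two buffers together form one queue of rate `R_H + R_L`. An error at delay
`d` needs the backlog of both streams at time `t - d` plus about `R_H d` later high-priority bits to
outlast `d` further uses, whence the exponent `E₀(ρ) - ρ R_H`; stability of the joint queue is the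
constraint `ρ ≤ ρ_HL`.

The converse is a counting argument: `s` unerased uses allow only `2 ^ s` output sequences, so with
`s < n` at least half of the `n`-bit prefixes are decoded wrongly, and averaging over prefixes
bounds the probability of so few successes (`System.real_successes_lt_le`). Tilting the binomial law
by `ρ` bounds that probability from below, which excludes `ρ R > E₀(ρ)` at reliability `E₀(ρ)`
(`System.Attains.mul_le_gallagerE0`).

Since `E₀` is strictly increasing and `E₀(ρ) / ρ` strictly decreasing, `α = E₀(ρ)` and `R = E₀(ρ) /
ρ` parametrize the capacity curve bijectively. The divergence is the unconstrained maximum of `E₀(ρ)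
- ρ R_H`, attained at `criticalSlope`; for small `R_L` this slope lies below `ρ_HL`, so the
constraint is inactive. -/

lemma mixture_pos (hb : 0 < b) (hb1 : b < 1) (ρ : ℝ) : 0 < b + (2 : ℝ) ^ (-ρ) * (1 - b) := by
  have h1 : 0 < 1 - b := by linarith
  positivity

lemma two_rpow_neg_gallagerE0 (hb : 0 < b) (hb1 : b < 1) (ρ : ℝ) :
    (2 : ℝ) ^ (-gallagerE0 b ρ) = b + (2 : ℝ) ^ (-ρ) * (1 - b) := by
  rw [gallagerE0, neg_neg, Real.rpow_logb (by norm_num) (by norm_num) (mixture_pos hb hb1 ρ)]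

lemma gallagerE0_zero : gallagerE0 b 0 = 0 := by simp [gallagerE0]

lemma continuous_gallagerE0 (hb : 0 < b) (hb1 : b < 1) : Continuous (gallagerE0 b) := by
  have h : Continuous fun ρ : ℝ => b + (2 : ℝ) ^ (-ρ) * (1 - b) := by
    have : Continuous fun ρ : ℝ => (2 : ℝ) ^ (-ρ) :=
      continuous_const.rpow continuous_neg fun _ => Or.inl (by norm_num)
    fun_prop
  unfold gallagerE0
  simp only [Real.logb]
  exact ((h.log fun ρ => (mixture_pos hb hb1 ρ).ne').div_const _).neg

lemma gallagerE0_strictMono (hb : 0 < b) (hb1 : b < 1) : StrictMono (gallagerE0 b) := by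
  intro x y hxy
  unfold gallagerE0
  have h1 : 0 < 1 - b := by linarith
  have h2 : (2 : ℝ) ^ (-y) < (2 : ℝ) ^ (-x) :=
    Real.rpow_lt_rpow_of_exponent_lt (by norm_num) (by linarith)
  have := Real.logb_lt_logb (b := 2) (by norm_num) (mixture_pos hb hb1 y)
    (show b + (2 : ℝ) ^ (-y) * (1 - b) < b + (2 : ℝ) ^ (-x) * (1 - b) by gcongr)
  linarith

lemma gallagerE0_pos (hb : 0 < b) (hb1 : b < 1) {ρ : ℝ} (hρ : 0 < ρ) : 0 < gallagerE0 b ρ := by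
  simpa [gallagerE0_zero] using gallagerE0_strictMono hb hb1 hρ

lemma gallagerE0_le (hb : 0 < b) (hb1 : b < 1) (ρ : ℝ) : gallagerE0 b ρ ≤ -Real.logb 2 b := by
  unfold gallagerE0
  have h1 : 0 < 1 - b := by linarith
  have := Real.logb_le_logb_of_le (b := 2) (by norm_num) hb
    (show b ≤ b + (2 : ℝ) ^ (-ρ) * (1 - b) by
      have : 0 < (2 : ℝ) ^ (-ρ) * (1 - b) := by positivity
      linarith)
  linarith

/-- Jensen's inequality for the logarithm: the line exponent lies below the divergence. -/
lemma gallagerE0_sub_le_binaryDiv (hb : 0 < b) (hb1 : b < 1) {R : ℝ} (hR : 0 < R) (hR1 : R < 1)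
    (ρ : ℝ) : gallagerE0 b ρ - ρ * R ≤ binaryDiv (1 - R) b := by
  have h1 : 0 < 1 - b := by linarith
  have h2 : 0 < 1 - R := by linarith
  have h3 : 0 < (2 : ℝ) ^ (-ρ) := by positivity
  -- With weights `1 - R` and `R`, these two points average to the argument of the logarithm in
  -- `gallagerE0`.
  have hJ := strictConcaveOn_log_Ioi.concaveOn.2 (x := b / (1 - R))
    (y := (2 : ℝ) ^ (-ρ) * (1 - b) / R) (Set.mem_Ioi.2 (by positivity))
    (Set.mem_Ioi.2 (by positivity)) h2.le hR.le (by ring)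
  simp only [smul_eq_mul] at hJ
  rw [show (1 - R) * (b / (1 - R)) + R * ((2 : ℝ) ^ (-ρ) * (1 - b) / R)
      = b + (2 : ℝ) ^ (-ρ) * (1 - b) by field_simp] at hJ
  rw [Real.log_div hb.ne' h2.ne', Real.log_div (by positivity) hR.ne',
    Real.log_mul h3.ne' h1.ne', Real.log_rpow (by norm_num)] at hJ
  have hl : 0 < Real.log 2 := Real.log_pos (by norm_num)
  simp only [gallagerE0, binaryDiv, Real.logb, sub_sub_cancel]
  rw [Real.log_div h2.ne' hb.ne', Real.log_div hR.ne' h1.ne']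
  rw [← mul_le_mul_iff_left₀ hl]
  field_simp
  linarith

/-- The slope parameter at which the line exponent of rate `R` meets the divergence. -/
noncomputable def criticalSlope (b R : ℝ) : ℝ := Real.logb 2 ((1 - b) * (1 - R) / (b * R))

lemma two_rpow_neg_criticalSlope (hb : 0 < b) (hb1 : b < 1) {R : ℝ} (hR : 0 < R) (hR1 : R < 1) :
    (2 : ℝ) ^ (-criticalSlope b R) = b * R / ((1 - b) * (1 - R)) := by
  have h1 : 0 < 1 - b := by linarith
  have h2 : 0 < 1 - R := by linarith
  rw [criticalSlope, Real.rpow_neg (by norm_num), Real.rpow_logb (by norm_num) (by norm_num)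
    (by positivity), inv_div]

/-- Equality case of Jensen: at this slope the two points averaged in `gallagerE0_sub_le_binaryDiv`
both equal `b / (1 - R)`. -/
lemma gallagerE0_sub_criticalSlope (hb : 0 < b) (hb1 : b < 1) {R : ℝ} (hR : 0 < R) (hR1 : R < 1) :
    gallagerE0 b (criticalSlope b R) - criticalSlope b R * R = binaryDiv (1 - R) b := by
  have h1 : 0 < 1 - b := by linarith
  have h2 : 0 < 1 - R := by linarith
  have hl : 0 < Real.log 2 := Real.log_pos (by norm_num)
  rw [gallagerE0, two_rpow_neg_criticalSlope hb hb1 hR hR1,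
    show b + b * R / ((1 - b) * (1 - R)) * (1 - b) = b / (1 - R) by field_simp; ring]
  simp only [criticalSlope, binaryDiv, Real.logb, sub_sub_cancel]
  rw [Real.log_div h2.ne' hb.ne', Real.log_div hR.ne' h1.ne', Real.log_div hb.ne' h2.ne',
    Real.log_div (by positivity) (by positivity), Real.log_mul h1.ne' h2.ne',
    Real.log_mul hb.ne' hR.ne']
  field_simp
  ring

lemma criticalSlope_pos (hb : 0 < b) {R : ℝ} (hR : 0 < R) (hR1 : R < 1 - b) :
    0 < criticalSlope b R := by
  apply Real.logb_pos (by norm_num)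
  rw [lt_div_iff₀ (by positivity)]
  nlinarith

/-- Every slope is critical for the rate of its tilted success probability. -/
lemma gallagerE0_sub_le_tilted (hb : 0 < b) (hb1 : b < 1) (ρ ρ' : ℝ) {p : ℝ}
    (hp : p = (2 : ℝ) ^ (-ρ) * (1 - b) / (b + (2 : ℝ) ^ (-ρ) * (1 - b))) :
    gallagerE0 b ρ' - ρ' * p ≤ gallagerE0 b ρ - ρ * p := by
  have h1 : 0 < 1 - b := by linarith
  have h3 : 0 < (2 : ℝ) ^ (-ρ) := by positivity
  have hc := mixture_pos hb hb1 ρ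
  have hp0 : 0 < p := by rw [hp]; positivity
  have h1p : 1 - p = b / (b + (2 : ℝ) ^ (-ρ) * (1 - b)) := by rw [hp]; field_simp; ring
  have hp1 : p < 1 := by
    have : 0 < 1 - p := by rw [h1p]; positivity
    linarith
  have hs : criticalSlope b p = ρ := by
    rw [criticalSlope, h1p, hp]
    rw [show (1 - b) * (b / (b + (2 : ℝ) ^ (-ρ) * (1 - b))) /
      (b * ((2 : ℝ) ^ (-ρ) * (1 - b) / (b + (2 : ℝ) ^ (-ρ) * (1 - b)))) = ((2 : ℝ) ^ (-ρ))⁻¹ by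
        field_simp]
    rw [← Real.rpow_neg (by norm_num), neg_neg, Real.logb_rpow (by norm_num) (by norm_num)]
  have := gallagerE0_sub_criticalSlope hb hb1 hp0 hp1
  rw [hs] at this
  rw [this]
  exact gallagerE0_sub_le_binaryDiv hb hb1 hp0 hp1 ρ'

/-- The tangent at slope `0`, where the tilted success probability is `1 - b`. It is needed mainly
to rule out negative slopes. -/
lemma gallagerE0_le_mul (hb : 0 < b) (hb1 : b < 1) (ρ : ℝ) : gallagerE0 b ρ ≤ ρ * (1 - b) := by
  have := gallagerE0_sub_le_tilted hb hb1 0 ρ (p := 1 - b) (by simp)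
  simp only [gallagerE0_zero, zero_mul, sub_zero] at this
  linarith

lemma mul_le_gallagerE0_criticalSlope (hb : 0 < b) (hb1 : b < 1) {R : ℝ} (hR : 0 < R)
    (hR1 : R < 1) : criticalSlope b R * R ≤ gallagerE0 b (criticalSlope b R) := by
  have h1 := gallagerE0_sub_criticalSlope hb hb1 hR hR1
  have h2 := gallagerE0_sub_le_binaryDiv hb hb1 hR hR1 0
  simp only [gallagerE0_zero, zero_mul, sub_zero] at h2
  linarith

/-- Strictness comes from moving to the critical slope of a larger rate `R' < 1 - b`, where the weak
inequality already holds. -/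
lemma exists_mul_lt_gallagerE0 (hb : 0 < b) (hb1 : b < 1) {R : ℝ} (hR : 0 < R)
    (hR1 : R < 1 - b) : ∃ ρ, 0 < ρ ∧ ρ * R < gallagerE0 b ρ := by
  obtain ⟨R', h1, h2⟩ := exists_between hR1
  have h3 := criticalSlope_pos hb (hR.trans h1) h2
  refine ⟨criticalSlope b R', h3, ?_⟩
  have h4 := mul_le_gallagerE0_criticalSlope hb hb1 (hR.trans h1) (by linarith)
  have := mul_lt_mul_of_pos_left h1 h3
  linarith

lemma criticalSlope_mul_lt_gallagerE0 (hb : 0 < b) (hb1 : b < 1) {R : ℝ} (hR : 0 < R)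
    (hR1 : R < 1 - b) : criticalSlope b R * R < gallagerE0 b (criticalSlope b R) := by
  have h1 := gallagerE0_sub_criticalSlope hb hb1 hR (by linarith)
  obtain ⟨ρ, -, h3⟩ := exists_mul_lt_gallagerE0 hb hb1 hR hR1
  have h2 := gallagerE0_sub_le_binaryDiv hb hb1 hR (by linarith) ρ
  linarith

/-- The ratio `E₀(ρ) / ρ` is strictly decreasing, by strict concavity of `x ↦ x ^ s`. -/
lemma gallagerE0_div_strictAntiOn (hb : 0 < b) (hb1 : b < 1) :
    StrictAntiOn (fun ρ => gallagerE0 b ρ / ρ) (Set.Ioi 0) := by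
  intro x hx y hy hxy
  rw [Set.mem_Ioi] at hx hy
  have h1 : 0 < 1 - b := by linarith
  -- The exponent `s = x / y` sends `2 ^ (-y)` to `2 ^ (-x)`, so Jensen compares `E₀(y) * (x / y)`
  -- with `E₀(x)`.
  have hs0 : 0 < x / y := by positivity
  have hs1 : x / y < 1 := (div_lt_one hy).2 hxy
  have hne : (1 : ℝ) ≠ (2 : ℝ) ^ (-y) :=
    (Real.rpow_lt_one_of_one_lt_of_neg (by norm_num) (by linarith)).ne'
  have hJ := (Real.strictConcaveOn_rpow hs0 hs1).2 (x := 1) (y := (2 : ℝ) ^ (-y))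
    (by simp) (Set.mem_Ici.2 (by positivity)) hne hb h1 (by ring)
  simp only [smul_eq_mul, Real.one_rpow, mul_one] at hJ
  rw [← Real.rpow_mul (by norm_num), show -y * (x / y) = -x by field_simp,
    mul_comm (1 - b), mul_comm (1 - b), ← two_rpow_neg_gallagerE0 hb hb1,
    ← two_rpow_neg_gallagerE0 hb hb1, ← Real.rpow_mul (by norm_num),
    Real.rpow_lt_rpow_left_iff (by norm_num)] at hJ
  have h5 : gallagerE0 b y * (x / y) < gallagerE0 b x := by linarith
  change gallagerE0 b y / y < gallagerE0 b x / x
  rw [div_lt_div_iff₀ hy hx]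
  rw [mul_div_assoc', div_lt_iff₀ hy] at h5
  exact h5

lemma exists_gallagerE0_eq_mul (hb : 0 < b) (hb1 : b < 1) {R : ℝ} (hR : 0 < R)
    (hR1 : R < 1 - b) : ∃ ρ, 0 < ρ ∧ gallagerE0 b ρ = ρ * R := by
  obtain ⟨x, hx, hxR⟩ := exists_mul_lt_gallagerE0 hb hb1 hR hR1
  have hcont : Continuous fun ρ => gallagerE0 b ρ - ρ * R :=
    (continuous_gallagerE0 hb hb1).sub (continuous_id.mul continuous_const)
  -- `E₀` never exceeds `-logb 2 b`, so the line `ρ * R` has caught up with it by the slope `-logb 2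
  -- b / R`.
  set y := max x (-Real.logb 2 b / R)
  have hy : gallagerE0 b y - y * R ≤ 0 := by
    have h1 := gallagerE0_le hb hb1 y
    have h2 : -Real.logb 2 b / R ≤ y := le_max_right _ _
    rw [div_le_iff₀ hR] at h2
    linarith
  obtain ⟨ρ, hρ, h⟩ := intermediate_value_Icc' (le_max_left x (-Real.logb 2 b / R))
    hcont.continuousOn (show (0 : ℝ) ∈ Set.Icc _ _ from ⟨hy, by linarith⟩)
  exact ⟨ρ, hx.trans_le hρ.1, by simpa [sub_eq_zero] using h⟩

/-- The equation `R = E₀(ρ) / ρ` has exactly one solution, and it is positive. -/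
lemma exists_eq_gallagerE0_div_iff (hb : 0 < b) (hb1 : b < 1) {R : ℝ} (hR : 0 < R)
    (hR1 : R < 1 - b) : ∃ r, 0 < r ∧ ∀ ρ, R = gallagerE0 b ρ / ρ ↔ ρ = r := by
  obtain ⟨r, hr, h⟩ := exists_gallagerE0_eq_mul hb hb1 hR hR1
  have hrR : R = gallagerE0 b r / r := by rw [h]; field_simp
  refine ⟨r, hr, fun ρ => ⟨fun hρ => ?_, fun hρ => hρ ▸ hrR⟩⟩
  rcases lt_trichotomy ρ 0 with h0 | h0 | h0
  · have h1 := gallagerE0_le_mul hb hb1 ρ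
    rw [eq_div_iff h0.ne] at hρ
    nlinarith
  · simp [h0] at hρ
    linarith
  · exact (gallagerE0_div_strictAntiOn hb hb1).injOn h0 hr (hρ.symm.trans hrR)

/-- The line exponent attains its maximum over a half-line at a nonnegative slope. -/
lemma exists_isMaxOn_gallagerE0_sub (hb : 0 < b) (hb1 : b < 1) {R r : ℝ} (hR1 : R < 1 - b)
    (hr : 0 < r) : ∃ s, 0 ≤ s ∧ s ≤ r ∧ ∀ ρ ≤ r,
      gallagerE0 b ρ - ρ * R ≤ gallagerE0 b s - s * R := by
  have hcont : Continuous fun ρ => gallagerE0 b ρ - ρ * R :=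
    (continuous_gallagerE0 hb hb1).sub (continuous_id.mul continuous_const)
  obtain ⟨s, hs, hmax⟩ := isCompact_Icc.exists_isMaxOn (Set.nonempty_Icc.2 hr.le)
    hcont.continuousOn
  refine ⟨s, hs.1, hs.2, fun ρ hρ => ?_⟩
  rcases le_total 0 ρ with h0 | h0
  · exact hmax ⟨h0, hρ⟩
  · have h1 := gallagerE0_le_mul hb hb1 ρ
    -- A negative slope gives at most `ρ * (1 - b - R) ≤ 0`, the value at slope `0`.
    have h2 : gallagerE0 b 0 - 0 * R ≤ gallagerE0 b s - s * R := hmax ⟨le_rfl, hr.le⟩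
    simp only [gallagerE0_zero, zero_mul, sub_zero] at h2
    nlinarith

end Exponents

/-! ### Events determined by finitely many channel uses -/

section Erasures

variable {β : unitInterval} {k : ℕ} {A B : Set (ℕ → Bool)}

instance : IsProbabilityMeasure (erasureMeasure β) := by
  unfold erasureMeasure; infer_instance

/-- This presents the event as a cylinder over a finite discrete space, which yields both
measurability and independence from later uses. -/
lemma preimage_restrict_image (hA : DependsOn (· ∈ A) (Set.Iio k)) :
    (Finset.range k).restrict ⁻¹' ((Finset.range k).restrict '' A) = A := by
  refine Set.Subset.antisymm ?_ (Set.subset_preimage_image _ _)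
  rintro ω ⟨ω', h, he⟩
  have h1 : (ω' ∈ A) = (ω ∈ A) := hA fun i hi => by
    simpa using congrFun he ⟨i, Finset.mem_range.2 hi⟩
  exact h1 ▸ h

lemma measurableSet_of_dependsOn (hA : DependsOn (· ∈ A) (Set.Iio k)) : MeasurableSet A := by
  rw [← preimage_restrict_image hA]
  exact (Finset.measurable_restrict _) (Set.toFinite _).measurableSet

lemma erasureMeasure_real_inter (hA : DependsOn (· ∈ A) (Set.Iio k)) (e : Bool) :
    (erasureMeasure β).real (A ∩ {ω | ω k = e})
      = (erasureMeasure β).real A * (if e then (β : ℝ) else 1 - β) := by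
  have hind : iIndepFun (fun (i : ℕ) (ω : ℕ → Bool) => ω i) (erasureMeasure β) :=
    iIndepFun_infinitePi (X := fun _ ω => ω) (by fun_prop)
  have h2 := (hind.indepFun_finset (Finset.range k) {k} (by simp)
    (by fun_prop)).measure_inter_preimage_eq_mul ((Finset.range k).restrict '' A) {f | f ⟨k, by simp⟩ = e} (Set.toFinite _).measurableSet
    (Set.toFinite _).measurableSet
  have h3 : (fun ω (i : Finset.range k) => ω i) ⁻¹' ((Finset.range k).restrict '' A) = A :=
    preimage_restrict_image hA
  have h4 : (erasureMeasure β).real {ω | ω k = e} = if e then (β : ℝ) else 1 - β := by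
    have : {ω : ℕ → Bool | ω k = e} = (fun ω : ℕ → Bool => ω k) ⁻¹' ({e} : Set Bool) := rfl
    rw [this, ← map_measureReal_apply (measurable_pi_apply k) (measurableSet_singleton e),
      erasureMeasure,
      show (fun ω : ℕ → Bool => ω k) = Function.eval k from rfl, Measure.infinitePi_map_eval,
      bernoulliMeasure_real_apply _ (measurableSet_singleton e)]
    cases e <;> simp
  rw [h3] at h2
  rw [← h4, measureReal_def, measureReal_def, measureReal_def, ← ENNReal.toReal_mul]
  exact congrArg ENNReal.toReal h2

/-- Conditioning an event on one fresh channel use. -/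
lemma erasureMeasure_real_step (hA : DependsOn (· ∈ A) (Set.Iio k))
    (hB : DependsOn (· ∈ B) (Set.Iio k)) :
    (erasureMeasure β).real {ω | if ω k then ω ∈ A else ω ∈ B}
      = β * (erasureMeasure β).real A + (1 - β) * (erasureMeasure β).real B := by
  have h : {ω : ℕ → Bool | if ω k then ω ∈ A else ω ∈ B}
      = (A ∩ {ω | ω k = true}) ∪ (B ∩ {ω | ω k = false}) := by
    ext ω
    cases h : ω k <;> simp [h]
  rw [h, measureReal_union, erasureMeasure_real_inter hA, erasureMeasure_real_inter hB]
  · simp; ring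
  · rw [Set.disjoint_left]
    rintro ω ⟨_, h1⟩ ⟨_, h2⟩
    simp_all
  · exact (measurableSet_of_dependsOn hB).inter
      (measurableSet_eq_fun (measurable_pi_apply k) measurable_const)

/-! ### The number of unerased uses and its binomial law. -/

lemma dependsOn_Iio_mono {X : Type*} {f : (ℕ → Bool) → X} (hf : DependsOn f (Set.Iio k)) {l : ℕ}
    (h : k ≤ l) : DependsOn f (Set.Iio l) :=
  fun _ _ hxy => hf fun i hi => hxy i (lt_of_lt_of_le hi h)

/-- The number of the first `t` channel uses that are not erased. -/
def successes (ω : ℕ → Bool) : ℕ → ℕ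
  | 0 => 0
  | t + 1 => successes ω t + (!ω t).toNat

lemma dependsOn_successes (t : ℕ) : DependsOn (fun ω => successes ω t) (Set.Iio t) := by
  induction t with
  | zero => intro _ _ _; rfl
  | succ t ih =>
    intro x y h
    have h1 := dependsOn_Iio_mono ih (Nat.le_succ t) h
    simp only [successes] at h1 ⊢
    rw [h1, h t (Nat.lt_succ_self t)]

lemma erasureMeasure_real_successes_eq (t m : ℕ) :
    (erasureMeasure β).real {ω | successes ω t = m}
      = t.choose m * (1 - (β : ℝ)) ^ m * (β : ℝ) ^ (t - m) := by
  induction t generalizing m with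
  | zero =>
    cases m with
    | zero => simp [successes]
    | succ m => simp [successes]
  | succ t ih =>
    have hdep : ∀ m, DependsOn (· ∈ {ω | successes ω t = m}) (Set.Iio t) := fun m x y h => by
      simp only [Set.mem_ofPred_eq]
      rw [show successes x t = successes y t from dependsOn_successes t h]
    cases m with
    | zero =>
      have h : {ω | successes ω (t + 1) = 0}
          = {ω | if ω t then ω ∈ {ω | successes ω t = 0} else ω ∈ (∅ : Set (ℕ → Bool))} := by
        ext ω
        cases h : ω t <;> simp [successes, h]
      rw [h, erasureMeasure_real_step (hdep 0) (fun _ _ _ => by simp), ih]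
      simp [pow_succ]; ring
    | succ m =>
      have h : {ω | successes ω (t + 1) = m + 1} = {ω | if ω t then
          ω ∈ {ω | successes ω t = m + 1} else ω ∈ {ω | successes ω t = m}} := by
        ext ω
        cases h : ω t <;> simp [successes, h]
      rw [h, erasureMeasure_real_step (hdep _) (hdep _), ih, ih, Nat.choose_succ_succ,
        Nat.add_sub_add_right]
      rcases lt_or_ge m t with hm | hm
      · rw [show t - m = t - (m + 1) + 1 by omega]
        push_cast
        ring
      · rw [Nat.choose_eq_zero_of_lt (show t < m + 1 by omega)]
        push_cast
        ring

end Erasures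

/-! ### Tail bounds for work-conserving queues -/

section Tails

variable {β : unitInterval}

/-- Chernoff's bound in recursive form: conditioning on use `k` turns the level `y` into `y` or `y -
1`, and the two bounds recombine to the factor `β + 2 ^ (-ρ) * (1 - β)`. -/
lemma tail_step (hβ : 0 < (β : ℝ)) (hβ1 : (β : ℝ) < 1) {k : ℕ} {F : (ℕ → Bool) → ℕ}
    (hF : DependsOn F (Set.Iio k)) {C ρ : ℝ}
    (hC : ∀ y : ℕ, (erasureMeasure β).real {ω | F ω < y} ≤ C * (2 : ℝ) ^ (ρ * y)) (y : ℕ) :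
    (erasureMeasure β).real {ω | F ω + (!ω k).toNat < y}
      ≤ C * (2 : ℝ) ^ (ρ * y) * (2 : ℝ) ^ (-gallagerE0 β ρ) := by
  have hC0 : 0 ≤ C := by simpa using measureReal_nonneg.trans (hC 0)
  cases y with
  | zero => simp; positivity
  | succ y =>
    have hdep : ∀ m, DependsOn (· ∈ {ω | F ω < m}) (Set.Iio k) := fun m x y h => by
      simp only [Set.mem_ofPred_eq]
      rw [hF h]
    have h : {ω | F ω + (!ω k).toNat < y + 1} = {ω | if ω k then
        ω ∈ {ω | F ω < y + 1} else ω ∈ {ω | F ω < y}} := by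
      ext ω
      cases h : ω k <;> simp [h]
    rw [h, erasureMeasure_real_step (hdep _) (hdep _), two_rpow_neg_gallagerE0 hβ hβ1]
    have h1 := mul_le_mul_of_nonneg_left (hC (y + 1)) hβ.le
    have h2 := mul_le_mul_of_nonneg_left (hC y) (sub_nonneg.2 hβ1.le)
    have h3 : (2 : ℝ) ^ (ρ * ((y + 1 : ℕ) : ℝ)) * (2 : ℝ) ^ (-ρ) = (2 : ℝ) ^ (ρ * y) := by
      rw [← Real.rpow_add (by norm_num)]
      push_cast
      ring_nf
    calc _ ≤ β * (C * (2 : ℝ) ^ (ρ * ((y + 1 : ℕ) : ℝ)))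
          + (1 - β) * (C * ((2 : ℝ) ^ (ρ * ((y + 1 : ℕ) : ℝ)) * (2 : ℝ) ^ (-ρ))) := by
          rw [h3]; exact add_le_add h1 h2
      _ = _ := by ring

/-- Lundberg's inequality for a queue that is served whenever fewer than `A (k + 1)` of its items
have left, where `A t` grows at least like `t * R`. -/
lemma tail_queue (hβ : 0 < (β : ℝ)) (hβ1 : (β : ℝ) < 1) {N : ℕ → (ℕ → Bool) → ℕ} {A : ℕ → ℕ}
    (hdep : ∀ k, DependsOn (N k) (Set.Iio k)) (hmono : ∀ k ω, N k ω ≤ N (k + 1) ω)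
    (hserved : ∀ k ω, N k ω < A (k + 1) → N (k + 1) ω = N k ω + (!ω k).toNat)
    {R c ρ : ℝ} (hA0 : A 0 = 0) (hA : ∀ t : ℕ, t * R ≤ A t + 1 + c) (hρ : 0 ≤ ρ)
    (hR : ρ * R ≤ gallagerE0 β ρ) (t y : ℕ) :
    (erasureMeasure β).real {ω | N t ω < y} ≤ (2 : ℝ) ^ (ρ * (c - t * R)) * (2 : ℝ) ^ (ρ * y) := by
  -- Above the number of arrivals the claimed bound is at least `1`; `c` absorbs the rounding in `A`
  -- beyond one bit.
  have key : ∀ (t y : ℕ), A t < y → (erasureMeasure β).real {ω | N t ω < y}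
      ≤ (2 : ℝ) ^ (ρ * (c - t * R)) * (2 : ℝ) ^ (ρ * y) := by
    intro t y hy
    rw [← Real.rpow_add (by norm_num), ← mul_add]
    refine measureReal_le_one.trans (Real.one_le_rpow (by norm_num) (mul_nonneg hρ ?_))
    have h1 := hA t
    have h2 : (A t : ℝ) + 1 ≤ y := by exact_mod_cast hy
    linarith
  induction t generalizing y with
  | zero =>
    rcases Nat.eq_zero_or_pos y with rfl | hy
    · simp; positivity
    · exact key 0 y (by omega)
  | succ t ih =>
    rcases lt_or_ge (A (t + 1)) y with hy | hy
    · exact key _ y hy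
    · have hsub : {ω | N (t + 1) ω < y} ⊆ {ω | N t ω + (!ω t).toNat < y} := by
        intro ω (hω : N (t + 1) ω < y)
        change N t ω + (!ω t).toNat < y
        rwa [← hserved t ω ((hmono t ω).trans_lt hω |>.trans_le hy)]
      refine (measureReal_mono hsub).trans ((tail_step hβ hβ1 (hdep t) ih y).trans ?_)
      rw [← Real.rpow_add (by norm_num), ← Real.rpow_add (by norm_num),
        ← Real.rpow_add (by norm_num)]
      apply Real.rpow_le_rpow_of_exponent_le (by norm_num)
      push_cast
      linarith

lemma tail_add_sum (hβ : 0 < (β : ℝ)) (hβ1 : (β : ℝ) < 1) {k : ℕ} {F : (ℕ → Bool) → ℕ}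
    (hF : DependsOn F (Set.Iio k)) {C ρ : ℝ}
    (hC : ∀ y : ℕ, (erasureMeasure β).real {ω | F ω < y} ≤ C * (2 : ℝ) ^ (ρ * y)) (d y : ℕ) :
    (erasureMeasure β).real {ω | F ω + ∑ i ∈ Finset.range d, (!ω (k + i)).toNat < y}
      ≤ C * (2 : ℝ) ^ (-(gallagerE0 β ρ * d)) * (2 : ℝ) ^ (ρ * y) := by
  induction d generalizing y with
  | zero => simpa using hC y
  | succ d ih =>
    have hdep : DependsOn (fun ω => F ω + ∑ i ∈ Finset.range d, (!ω (k + i)).toNat)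
        (Set.Iio (k + d)) := by
      intro x y h
      have h1 : F x = F y := dependsOn_Iio_mono hF (Nat.le_add_right k d) h
      simp only [h1]
      congr 1
      refine Finset.sum_congr rfl fun i hi => ?_
      rw [h (k + i) (by simpa using hi)]
    have := tail_step hβ hβ1 hdep ih y
    simp only [Finset.sum_range_succ, ← add_assoc]
    refine this.trans_eq ?_
    rw [show -(gallagerE0 β ρ * ((d + 1 : ℕ) : ℝ)) = -(gallagerE0 β ρ * d) + -gallagerE0 β ρ by
      push_cast; ring, Real.rpow_add (by norm_num)]
    ring

end Tails

/-! ### Bits removed from the buffers -/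

section Scheme

lemma arrived_zero (R : ℝ) : arrived R 0 = 0 := by simp [arrived]

lemma arrived_mono {R : ℝ} (hR : 0 ≤ R) : Monotone (arrived R) := fun s t h => by
  unfold arrived; gcongr

lemma arrived_le {R : ℝ} (hR : 0 ≤ R) (t : ℕ) : (arrived R t : ℝ) ≤ t * R :=
  Nat.floor_le (by positivity)

lemma lt_arrived_add_one (R : ℝ) (t : ℕ) : t * R < arrived R t + 1 := Nat.lt_floor_add_one _

/-- The numbers of bits removed from the buffers in the first `t` channel uses. -/
noncomputable def removed (R : Stream → ℝ) (ω : ℕ → Bool) : ℕ → Stream → ℕ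
  | 0, _ => 0
  | k + 1, p => removed R ω k p
      + if served R k (removed R ω k) = some p then (!ω k).toNat else 0

variable {R : Stream → ℝ} {ω : ℕ → Bool} {k t : ℕ} {p : Stream}

lemma lt_arrived_of_served {n : Stream → ℕ} (h : served R k n = some p) :
    n p < arrived (R p) (k + 1) := by
  unfold served at h
  split_ifs at h with h1 h2
  · cases h; exact h1
  · cases h; exact h2

lemma dependsOn_removed (R : Stream → ℝ) (t : ℕ) :
    DependsOn (fun ω => removed R ω t) (Set.Iio t) := by
  induction t with
  | zero => intro x y _; ext p; rfl
  | succ t ih =>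
    intro x y h
    have h1 := dependsOn_Iio_mono ih (Nat.le_succ t) h
    ext p
    simp only [removed] at h1 ⊢
    rw [h1, h t (Nat.lt_succ_self t)]

lemma removed_mono : Monotone fun t => removed R ω t p :=
  monotone_nat_of_le_succ fun _ => Nat.le_add_right _ _

lemma removed_le_arrived (hR : 0 ≤ R p) (t : ℕ) : removed R ω t p ≤ arrived (R p) t := by
  induction t with
  | zero => simp [removed]
  | succ t ih =>
    have h1 := arrived_mono hR (Nat.le_succ t)
    have h2 := Bool.toNat_le (!ω t)
    simp only [removed]
    split_ifs with h
    · have := lt_arrived_of_served h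
      omega
    · simpa using ih.trans h1

lemma removed_high_succ (h : removed R ω k .high < arrived (R .high) (k + 1)) :
    removed R ω (k + 1) .high = removed R ω k .high + (!ω k).toNat := by
  simp [removed, served, h]

/-- Work conservation: if either buffer is nonempty, a success removes exactly one bit from one of
them. -/
lemma removed_add_succ (h : removed R ω k .high < arrived (R .high) (k + 1) ∨
      removed R ω k .low < arrived (R .low) (k + 1)) :
    removed R ω (k + 1) .high + removed R ω (k + 1) .low
      = removed R ω k .high + removed R ω k .low + (!ω k).toNat := by
  by_cases h1 : removed R ω k .high < arrived (R .high) (k + 1)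
  · simp [removed, served, h1]; ring
  · simp [removed, served, h1, h.resolve_left h1]; ring

/-! ### Correctness of the decoder and reliability of the two streams. -/

variable {RH RL : ℝ}
  (guess : (t : ℕ) → (Fin t → Option Bool) → Stream → ℕ → Bool) (S : Stream → ℕ → Bool)

lemma priorityScheme_enc {z : Fin k → Option Bool} {n : Stream → ℕ}
    (hn : (fun p => (received (rates RH RL) k z p).length) = n)
    (hs : served (rates RH RL) k n = some p) :
    (priorityScheme RH RL guess).enc k z (fun i j => S i j) = S p (n p) := by
  subst hn
  have hlt := lt_arrived_of_served hs
  simp only [priorityScheme, hs]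
  exact dif_pos hlt

lemma priorityScheme_dec (z : Fin t → Option Bool) (j : Fin (arrived (rates RH RL p) t)) :
    (priorityScheme RH RL guess).dec t z p j
      = ((received (rates RH RL) t z p)[(j : ℕ)]?).getD (guess t z p j) := rfl

/-- The received bits are an initial segment of the message. -/
lemma received_outputs (ω : ℕ → Bool) (t : ℕ) (p : Stream) :
    received (rates RH RL) t ((priorityScheme RH RL guess).outputs S ω t) p
      = (List.range (removed (rates RH RL) ω t p)).map (S p) := by
  induction t generalizing p with
  | zero => simp [received, removed]
  | succ k ih =>
    have hn : (fun p => (received (rates RH RL) k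
        ((priorityScheme RH RL guess).outputs S ω k) p).length) = removed (rates RH RL) ω k := by
      ext p; simp [ih]
    simp only [received, System.outputs, Fin.init_snoc, Fin.snoc_last, hn, removed]
    rcases hs : served (rates RH RL) k (removed (rates RH RL) ω k) with _ | q
    · simp [ih]
    · rw [priorityScheme_enc guess S hn hs]
      cases hω : ω k
      · by_cases hpq : q = p
        · subst hpq
          simp [erase, ih, List.range_succ]
        · simp [erase, ih, hpq, Function.update_of_ne (Ne.symm hpq)]
      · simp [erase, ih]

/-- Received bits are always right, so only a missing bit can cause an error; hence no bound depends
on `guess`. -/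
lemma errorEvent_subset (t d : ℕ) :
    (priorityScheme RH RL guess).errorEvent S p t d
      ⊆ {ω | removed (rates RH RL) ω t p < arrived (rates RH RL p) (t - d)} := by
  rintro ω ⟨j, hj, hne⟩
  by_contra hlt
  simp only [Set.mem_ofPred_eq, not_lt] at hlt
  apply hne
  have hj' : (j : ℕ) < removed (rates RH RL) ω t p := hj.trans_le hlt
  rw [priorityScheme_dec, received_outputs]
  simp [hj']

variable {β : unitInterval}

/-- The high-priority stream has the reliability of a retransmission queue of its own. -/
lemma priorityScheme_attains_high (hβ : 0 < (β : ℝ)) (hβ1 : (β : ℝ) < 1) (hRH : 0 ≤ RH) {ρ : ℝ}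
    (hρ : 0 ≤ ρ) (hR : ρ * RH ≤ gallagerE0 β ρ) :
    (priorityScheme RH RL guess).Attains β .high (ρ * RH) := by
  -- The bound holds with constant `1`; the `2` makes it strict.
  refine ⟨2, fun S t d hd => ?_⟩
  refine (measureReal_mono (errorEvent_subset guess S t d)).trans_lt ?_
  have h1 := tail_queue hβ hβ1 (N := fun k ω => removed (rates RH RL) ω k .high)
    (A := arrived RH) (R := RH) (c := 0) (ρ := ρ)
    (fun k x y h => by simp only [show removed _ x k = removed _ y k from dependsOn_removed _ k h])
    (fun k ω => removed_mono (Nat.le_succ k)) (fun k ω h => removed_high_succ h)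
    (arrived_zero RH) (fun t => by linarith [lt_arrived_add_one RH t]) hρ hR t
    (arrived RH (t - d))
  refine h1.trans_lt ?_
  have h2 := arrived_le hRH (t - d)
  rw [Nat.cast_sub hd] at h2
  have h3 := mul_le_mul_of_nonneg_left h2 hρ
  have h4 : (2 : ℝ) ^ (ρ * (0 - t * RH)) * (2 : ℝ) ^ (ρ * (arrived RH (t - d) : ℝ))
      ≤ (2 : ℝ) ^ (-(ρ * RH * d)) := by
    rw [← Real.rpow_add (by norm_num)]
    apply Real.rpow_le_rpow_of_exponent_le (by norm_num)
    linarith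
  have h5 : 0 < (2 : ℝ) ^ (-(ρ * RH * d)) := by positivity
  linarith

/-- While an old low-priority bit waits, every channel use serves some buffer. -/
lemma removed_add_of_low_lt (hRL : 0 ≤ RL) {u d : ℕ}
    (h : removed (rates RH RL) ω (u + d) .low < arrived RL u) {j : ℕ} (hj : j ≤ d) :
    removed (rates RH RL) ω (u + j) .high + removed (rates RH RL) ω (u + j) .low
      = removed (rates RH RL) ω u .high + removed (rates RH RL) ω u .low
        + ∑ i ∈ Finset.range j, (!ω (u + i)).toNat := by
  induction j with
  | zero => simp
  | succ j ih =>
    rw [Finset.sum_range_succ, ← add_assoc, ← add_assoc, ← ih (by omega)]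
    apply removed_add_succ
    right
    have h1 : removed (rates RH RL) ω (u + j) .low ≤ removed (rates RH RL) ω (u + d) .low :=
      removed_mono (p := .low) (by omega : u + j ≤ u + d)
    have h2 : arrived RL u ≤ arrived RL (u + j + 1) := arrived_mono hRL (by omega)
    exact h1.trans_lt (h.trans_le h2)

/-- The low-priority stream: the backlog of both streams at the time `t - d` and the
high-priority bits that arrive later delay the low-priority bits. -/
lemma priorityScheme_attains_low (hβ : 0 < (β : ℝ)) (hβ1 : (β : ℝ) < 1) (hRH : 0 ≤ RH)
    (hRL : 0 ≤ RL) {ρ : ℝ} (hρ : 0 ≤ ρ) (hR : ρ * (RH + RL) ≤ gallagerE0 β ρ) :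
    (priorityScheme RH RL guess).Attains β .low (gallagerE0 β ρ - ρ * RH) := by
  -- The factor `2 ^ ρ` pays for rounding the arrivals of two streams, the `c = 1` below.
  refine ⟨2 * (2 : ℝ) ^ ρ, fun S t d hd => ?_⟩
  obtain ⟨u, rfl⟩ := Nat.exists_eq_add_of_le' hd
  set N : ℕ → (ℕ → Bool) → ℕ := fun k ω =>
    removed (rates RH RL) ω k .high + removed (rates RH RL) ω k .low with hN
  have hdep : ∀ k, DependsOn (N k) (Set.Iio k) := fun k x y h => by
    simp only [hN, show removed _ x k = removed _ y k from dependsOn_removed _ k h]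
  -- High-priority arrivals count up to `u + d` but low-priority ones only up to `u`; this asymmetry
  -- produces the loss `ρ * RH` per unit of delay.
  have hsub : (priorityScheme RH RL guess).errorEvent S .low (u + d) d
      ⊆ {ω | N u ω + ∑ i ∈ Finset.range d, (!ω (u + i)).toNat
        < arrived RH (u + d) + arrived RL u} := by
    intro ω hω
    have h1 := errorEvent_subset guess S (u + d) d hω
    simp only [Set.mem_ofPred_eq, Nat.add_sub_cancel] at h1
    have h2 := removed_add_of_low_lt hRL h1 le_rfl
    have h3 : removed (rates RH RL) ω (u + d) .high ≤ arrived RH (u + d) :=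
      removed_le_arrived hRH _
    change _ < arrived RL u at h1
    change N u ω + _ < _
    simp only [hN]
    omega
  refine (measureReal_mono hsub).trans_lt ?_
  have h1 := tail_queue hβ hβ1 (N := N) (A := fun t => arrived RH t + arrived RL t)
    (R := RH + RL) (c := 1) (ρ := ρ) hdep
    (fun k ω => add_le_add (removed_mono (Nat.le_succ k)) (removed_mono (Nat.le_succ k)))
    (fun k ω h => removed_add_succ (by
      by_contra! h'
      have h3 : arrived RH (k + 1) ≤ _ := h'.1
      have h4 : arrived RL (k + 1) ≤ _ := h'.2
      simp only [hN] at h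
      omega))
    (by simp [arrived_zero]) (fun t => by
      have h3 := lt_arrived_add_one RH t
      have h4 := lt_arrived_add_one RL t
      push_cast
      linarith) hρ hR u
  have h2 := tail_add_sum hβ hβ1 (hdep u) h1 d (arrived RH (u + d) + arrived RL u)
  refine h2.trans_lt ?_
  have h3 := arrived_le hRH (u + d)
  have h4 := arrived_le hRL u
  push_cast at h3
  have h5 := mul_le_mul_of_nonneg_left (add_le_add h3 h4) hρ
  have h6 : (2 : ℝ) ^ (ρ * (1 - u * (RH + RL))) * (2 : ℝ) ^ (-(gallagerE0 β ρ * d))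
      * (2 : ℝ) ^ (ρ * ((arrived RH (u + d) + arrived RL u : ℕ) : ℝ))
      ≤ (2 : ℝ) ^ ρ * (2 : ℝ) ^ (-((gallagerE0 β ρ - ρ * RH) * d)) := by
    rw [← Real.rpow_add (by norm_num), ← Real.rpow_add (by norm_num),
      ← Real.rpow_add (by norm_num)]
    apply Real.rpow_le_rpow_of_exponent_le (by norm_num)
    push_cast
    linarith
  have h7 : 0 < (2 : ℝ) ^ ρ * (2 : ℝ) ^ (-((gallagerE0 β ρ - ρ * RH) * d)) := by positivity
  linarith

/-- The single-stream system obtained from a two-stream one by making the low-priority stream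
constant. -/
def System.restrictHigh (sys : System (rates RH RL)) : System (fun _ : Unit => RH) where
  enc k z m := sys.enc k z fun
    | .high => m ()
    | .low => fun _ => false
  dec t z _ := sys.dec t z .high

/-- The messages of both streams, with a constant low-priority stream. -/
def highMessage (S : Unit → ℕ → Bool) : Stream → ℕ → Bool
  | .high => S ()
  | .low => fun _ => false

lemma System.outputs_restrictHigh (sys : System (rates RH RL)) (S : Unit → ℕ → Bool)
    (ω : ℕ → Bool) (t : ℕ) :
    sys.restrictHigh.outputs S ω t = sys.outputs (highMessage S) ω t := by
  induction t with
  | zero => rfl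
  | succ k ih =>
    simp only [System.outputs, ih]
    congr 2
    simp only [System.restrictHigh]
    congr 1
    ext p j
    cases p <;> rfl

/-- Reliability is uniform in the messages, so freezing the low-priority stream preserves it; the
single-stream converse thereby limits the scheme. -/
lemma System.Attains.restrictHigh {sys : System (rates RH RL)} {α : ℝ}
    (h : sys.Attains β .high α) : sys.restrictHigh.Attains β () α := by
  obtain ⟨K, hK⟩ := h
  refine ⟨K, fun S t d hd => ?_⟩
  have : sys.restrictHigh.errorEvent S () t d = sys.errorEvent (highMessage S) .high t d := by
    ext ω
    simp only [System.errorEvent, System.outputs_restrictHigh]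
    rfl
  rw [this]
  exact hK _ t d hd

lemma System.Attains.mono {ι : Type} {R : ι → ℝ} {sys : System R} {i : ι} {α α' : ℝ}
    (h : sys.Attains β i α) (hα : α' ≤ α) : sys.Attains β i α' := by
  obtain ⟨K, hK⟩ := h
  refine ⟨K, fun S t d hd => (hK S t d hd).trans_le ?_⟩
  have hK0 : 0 < K :=
    pos_of_mul_pos_left (measureReal_nonneg.trans_lt (hK S t d hd)) (by positivity)
  gcongr
  norm_num

end Scheme

/-! ### Upper bound on the rate of a reliable system -/

section Converse

lemma System.dependsOn_outputs {ι : Type} {R : ι → ℝ} (sys : System R) (S : ι → ℕ → Bool) (t : ℕ) :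
    DependsOn (fun ω => sys.outputs S ω t) (Set.Iio t) := by
  induction t with
  | zero => intro x y _; rfl
  | succ t ih =>
    intro x y h
    have h1 := dependsOn_Iio_mono ih (Nat.le_succ t) h
    simp only [System.outputs] at h1 ⊢
    rw [h1, h t (Nat.lt_succ_self t)]

lemma System.dependsOn_errorEvent {ι : Type} {R : ι → ℝ} (sys : System R) (S : ι → ℕ → Bool)
    (i : ι) (t d : ℕ) : DependsOn (· ∈ sys.errorEvent S i t d) (Set.Iio t) := by
  intro x y h
  simp only [System.errorEvent, Set.mem_ofPred_eq]
  rw [show sys.outputs S x t = sys.outputs S y t from sys.dependsOn_outputs S t h]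

/-- With `s` unerased uses, at most `2 ^ s` output sequences are possible. -/
lemma System.card_image_outputs_le {ι : Type} {R : ι → ℝ} (sys : System R)
    (T : Finset (ι → ℕ → Bool)) (ω : ℕ → Bool) (t : ℕ) :
    (T.image fun S => sys.outputs S ω t).card ≤ 2 ^ successes ω t := by
  induction t with
  | zero =>
    refine (Finset.card_le_univ _).trans ?_
    simp [successes]
  | succ t ih =>
    cases h : ω t with
    | true =>
      have hsub : (T.image fun S => sys.outputs S ω (t + 1))
          ⊆ (T.image fun S => sys.outputs S ω t).image
            fun z => Fin.snoc (α := fun _ => Option Bool) z none := by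
        intro z hz
        obtain ⟨S, hS, rfl⟩ := Finset.mem_image.1 hz
        refine Finset.mem_image.2 ⟨_, Finset.mem_image_of_mem _ hS, ?_⟩
        simp [System.outputs, erase, h]
      refine (Finset.card_le_card hsub).trans (Finset.card_image_le.trans ?_)
      simpa [successes, h] using ih
    | false =>
      have hsub : (T.image fun S => sys.outputs S ω (t + 1))
          ⊆ ((T.image fun S => sys.outputs S ω t) ×ˢ (Finset.univ : Finset Bool)).image
            fun z => Fin.snoc (α := fun _ => Option Bool) z.1 (some z.2) := by
        intro z hz
        obtain ⟨S, hS, rfl⟩ := Finset.mem_image.1 hz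
        refine Finset.mem_image.2 ⟨(sys.outputs S ω t, sys.enc t (sys.outputs S ω t)
          fun i j => S i j), Finset.mem_product.2
            ⟨Finset.mem_image_of_mem _ hS, Finset.mem_univ _⟩, ?_⟩
        simp [System.outputs, erase, h]
      refine (Finset.card_le_card hsub).trans (Finset.card_image_le.trans ?_)
      simpa [successes, h, pow_succ] using ih

/-- The message with the first bits `w` and all later bits `false`. -/
def padded {n : ℕ} (w : Fin n → Bool) : Unit → ℕ → Bool := fun _ j =>
  if h : j < n then w ⟨j, h⟩ else false

open Classical in
/-- With fewer than `n` unerased uses, at least half of the `n`-bit prefixes are not decoded. -/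
lemma System.two_pow_le_card_error {R : ℝ} (hR : 0 ≤ R) (sys : System (fun _ : Unit => R))
    (t d : ℕ) (ω : ℕ → Bool) (hs : successes ω t < arrived R (t - d)) :
    2 ^ arrived R (t - d) ≤ 2 * (Finset.univ.filter fun w : Fin (arrived R (t - d)) → Bool =>
      ω ∈ sys.errorEvent (padded w) () t d).card := by
  set n := arrived R (t - d) with hn
  have hnt : n ≤ arrived R t := arrived_mono hR (Nat.sub_le t d)
  set G := Finset.univ.filter fun w : Fin n → Bool => ¬ ω ∈ sys.errorEvent (padded w) () t d
    with hG
  -- Off the error event the outputs determine the first `n` bits.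
  have hinj : Set.InjOn (fun w : Fin n → Bool => sys.outputs (padded w) ω t) G := by
    intro w hw w' hw' h
    have hdec : ∀ v ∈ G, ∀ j : Fin n,
        sys.dec t (sys.outputs (padded v) ω t) () (Fin.castLE hnt j) = v j := by
      intro v hv j
      by_contra hne
      refine (Finset.mem_filter.1 hv).2 ⟨Fin.castLE hnt j, j.2, ?_⟩
      simpa [padded] using hne
    ext j
    change sys.outputs (padded w) ω t = sys.outputs (padded w') ω t at h
    rw [← hdec w hw j, ← hdec w' hw' j, h]
  have hcard : G.card ≤ 2 ^ successes ω t := by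
    rw [← Finset.card_image_of_injOn hinj]
    refine le_trans (le_of_eq ?_)
      (sys.card_image_outputs_le (G.image fun w => padded w) ω t)
    rw [Finset.image_image]
    rfl
  have hpow : 2 * 2 ^ successes ω t ≤ 2 ^ n := by
    rw [← pow_succ']
    exact Nat.pow_le_pow_right (by norm_num) hs
  have htot := Finset.card_filter_add_card_filter_not (s := (Finset.univ : Finset (Fin n → Bool)))
    (fun w => ω ∈ sys.errorEvent (padded w) () t d)
  simp only [Finset.card_univ, Fintype.card_fun, Fintype.card_bool, Fintype.card_fin] at htot
  change _ + G.card = _ at htot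
  omega

variable {β : unitInterval}

/-- If all error probabilities are at most `ε`, then too few unerased uses are unlikely. -/
lemma System.real_successes_lt_le {R : ℝ} (hR : 0 ≤ R) (sys : System (fun _ : Unit => R))
    (t d : ℕ) {ε : ℝ}
    (hε : ∀ S, (erasureMeasure β).real (sys.errorEvent S () t d) ≤ ε) :
    (erasureMeasure β).real {ω | successes ω t < arrived R (t - d)} ≤ 2 * ε := by
  classical
  set n := arrived R (t - d) with hn
  set E : (Fin n → Bool) → Set (ℕ → Bool) := fun w => sys.errorEvent (padded w) () t d
  have hE : ∀ w, MeasurableSet (E w) := fun w =>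
    measurableSet_of_dependsOn (sys.dependsOn_errorEvent _ _ _ _)
  have hA : MeasurableSet {ω : ℕ → Bool | successes ω t < n} :=
    measurableSet_of_dependsOn (k := t) fun x y h => by
      simp only [Set.mem_ofPred_eq]
      rw [show successes x t = successes y t from dependsOn_successes t h]
  have hint : ∀ w, Integrable ((E w).indicator (1 : (ℕ → Bool) → ℝ)) (erasureMeasure β) :=
    fun w => (integrable_const (1 : ℝ)).indicator (hE w)
  have h1 : ∑ w, (erasureMeasure β).real (E w)
      = ∫ ω, ∑ w, (E w).indicator (1 : (ℕ → Bool) → ℝ) ω ∂erasureMeasure β := by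
    rw [integral_finsetSum _ fun w _ => hint w]
    exact Finset.sum_congr rfl fun w _ => (integral_indicator_one (hE w)).symm
  -- Double counting: the pointwise bound on the number of wrong prefixes is integrated over the
  -- erasure patterns.
  have h2 : (2 : ℝ) ^ n * (erasureMeasure β).real {ω | successes ω t < n}
      ≤ 2 * ∑ w, (erasureMeasure β).real (E w) := by
    rw [h1, ← integral_indicator_one hA, ← integral_const_mul, ← integral_const_mul]
    refine integral_mono (((integrable_const (1 : ℝ)).indicator hA).const_mul _)
      ((integrable_finsetSum _ fun w _ => hint w).const_mul _) fun ω => ?_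
    have hsum : ∑ w, (E w).indicator (1 : (ℕ → Bool) → ℝ) ω
        = ((Finset.univ.filter fun w => ω ∈ E w).card : ℝ) := by
      simp [Set.indicator_apply, Finset.sum_boole]
    simp only [hsum]
    by_cases hω : successes ω t < n
    · rw [Set.indicator_of_mem (show ω ∈ {ω | successes ω t < n} from hω), Pi.one_apply, mul_one]
      exact_mod_cast sys.two_pow_le_card_error hR t d ω hω
    · rw [Set.indicator_of_notMem (show ω ∉ {ω | successes ω t < n} from hω), mul_zero]
      positivity
  have h3 : ∑ w, (erasureMeasure β).real (E w) ≤ 2 ^ n * ε := by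
    refine (Finset.sum_le_sum fun w _ => hε (padded w)).trans_eq ?_
    simp
  have h4 : (0 : ℝ) < 2 ^ n := by positivity
  refine le_of_mul_le_mul_left (h2.trans ?_) h4
  linarith

/-- A mode of the binomial distribution is near the mean and has at least average mass. -/
lemma exists_binomial_mode {p : ℝ} (hp : 0 < p) (hp1 : p < 1) (t : ℕ) :
    ∃ j ≤ t, t * p - 1 ≤ j ∧ (j : ℝ) ≤ (t + 1) * p ∧
      1 ≤ (t + 1) * (t.choose j * p ^ j * (1 - p) ^ (t - j)) := by
  set f : ℕ → ℝ := fun j => t.choose j * p ^ j * (1 - p) ^ (t - j) with hf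
  have h1p : 0 < 1 - p := by linarith
  obtain ⟨j, hj, hmax⟩ := Finset.exists_max_image (Finset.range (t + 1)) f ⟨0, by simp⟩
  have hjt : j ≤ t := Nat.lt_succ_iff.1 (Finset.mem_range.1 hj)
  have hpos : ∀ i ≤ t, 0 < f i := fun i hi => by
    have : 0 < (t.choose i : ℝ) := by exact_mod_cast Nat.choose_pos hi
    simp only [hf]
    positivity
  -- Ratio of consecutive masses, cross-multiplied; comparing the mode with its right and left
  -- neighbours gives its lower and upper bounds.
  have hratio : ∀ i < t, f (i + 1) * ((i + 1) * (1 - p)) = f i * ((t - i) * p) := fun i hi => by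
    have h := Nat.choose_succ_right_eq t i
    have h' : (t.choose (i + 1) : ℝ) * (i + 1) = t.choose i * (t - i) := by
      rw [← Nat.cast_sub hi.le]; exact_mod_cast h
    simp only [hf]
    rw [show t - i = t - (i + 1) + 1 by omega, pow_succ, pow_succ]
    linear_combination p ^ i * p * ((1 - p) ^ (t - (i + 1)) * (1 - p)) * h'
  refine ⟨j, hjt, ?_, ?_, ?_⟩
  · rcases hjt.lt_or_eq with h | h
    · have h1 := hratio j h
      have h2 := hmax (j + 1) (Finset.mem_range.2 (by omega))
      have h3 : f j * ((t - j) * p) ≤ f j * ((j + 1) * (1 - p)) := by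
        rw [← h1]; gcongr
      have h4 := le_of_mul_le_mul_left h3 (hpos j hjt)
      linarith
    · rw [h]
      have : (0 : ℝ) ≤ t := by positivity
      nlinarith
  · cases j with
    | zero => simp; positivity
    | succ i =>
      have h1 := hratio i (by omega)
      have h2 := hmax i (Finset.mem_range.2 (by omega))
      have h5 : (0 : ℝ) ≤ t - i := by
        have : (i : ℝ) + 1 ≤ t := by exact_mod_cast hjt
        linarith
      have h3 : f (i + 1) * ((i + 1) * (1 - p)) ≤ f (i + 1) * ((t - i) * p) := by
        rw [h1]; gcongr
      have h4 := le_of_mul_le_mul_left h3 (hpos _ hjt)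
      push_cast
      linarith
  -- The `t + 1` masses sum to `1`, so the largest is at least `1 / (t + 1)`.
  · have h1 : ∑ i ∈ Finset.range (t + 1), f i = 1 := by
      have := add_pow p (1 - p) t
      rw [add_sub_cancel, one_pow] at this
      rw [this]
      exact Finset.sum_congr rfl fun i _ => by simp only [hf]; ring
    have h2 := Finset.sum_le_card_nsmul _ _ _ hmax
    rw [h1] at h2
    simpa using h2

lemma lt_of_forall_two_rpow_le {a C K : ℝ} (ha : 0 < a)
    (h : ∀ᶠ t : ℕ in Filter.atTop, (2 : ℝ) ^ (a * t - C) ≤ K * (t + 1)) : False := by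
  have hr : 1 < (2 : ℝ) ^ a := Real.one_lt_rpow (by norm_num) ha
  have h1 := tendsto_pow_const_div_const_pow_of_one_lt 1 hr
  have h0 := tendsto_pow_const_div_const_pow_of_one_lt 0 hr
  have h2 := ((h1.add h0).const_mul K)
  simp only [add_zero, mul_zero, pow_one, pow_zero] at h2
  have h3 : 0 < (2 : ℝ) ^ (-C) := by positivity
  obtain ⟨t, ht, ht'⟩ := (h.and (h2.eventually_lt_const h3)).exists
  have h4 : 0 < ((2 : ℝ) ^ a) ^ t := by positivity
  rw [sub_eq_add_neg, Real.rpow_add (by norm_num), Real.rpow_mul (by norm_num),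
    Real.rpow_natCast] at ht
  rw [← add_div, mul_div_assoc', div_lt_iff₀ h4] at ht'
  linarith

/-- A system with feedback and reliability `E₀(ρ)` has at most the rate `E₀(ρ) / ρ`. -/
lemma System.Attains.mul_le_gallagerE0 (hβ : 0 < (β : ℝ)) (hβ1 : (β : ℝ) < 1) {R : ℝ}
    (hR : 0 ≤ R) {sys : System (fun _ : Unit => R)} {ρ : ℝ} (hρ : 0 < ρ)
    (h : sys.Attains β () (gallagerE0 β ρ)) : ρ * R ≤ gallagerE0 β ρ := by
  by_contra! hlt
  obtain ⟨K, hK⟩ := h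
  set e := gallagerE0 β ρ with he
  have he0 : 0 < e := gallagerE0_pos hβ hβ1 hρ
  have hc := mixture_pos hβ hβ1 ρ
  set c := (β : ℝ) + (2 : ℝ) ^ (-ρ) * (1 - β) with hcdef
  have hce : c = (2 : ℝ) ^ (-e) := (two_rpow_neg_gallagerE0 hβ hβ1 ρ).symm
  have hq : 0 < 1 - (β : ℝ) := by linarith
  have h2ρ : 0 < (2 : ℝ) ^ (-ρ) := by positivity
  -- The success probability tilted by `ρ`. By the tangent at `ρ` it satisfies `ρ * p ≤ e`, hence `p
  -- < R`.
  set p := (2 : ℝ) ^ (-ρ) * (1 - β) / c with hp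
  have hp0 : 0 < p := by positivity
  have h1p : 1 - p = β / c := by rw [hp]; field_simp; rw [hcdef]; ring
  have hp1 : p < 1 := by
    have : 0 < 1 - p := by rw [h1p]; positivity
    linarith
  have hpe : ρ * p ≤ e := by
    have := gallagerE0_sub_le_tilted hβ hβ1 ρ 0 hp
    simp only [gallagerE0_zero, zero_mul, sub_zero] at this
    linarith
  have hpR : p < R := lt_of_mul_lt_mul_left (hpe.trans_lt hlt) hρ.le
  have hR0 : 0 < R := hp0.trans hpR
  have hqp : 1 - (β : ℝ) = p * (c * (2 : ℝ) ^ ρ) := by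
    rw [hp, Real.rpow_neg (by norm_num)]; field_simp
  have hβp : (β : ℝ) = (1 - p) * c := by rw [h1p]; field_simp
  have ha : 0 < p * (ρ - e / R) := by
    apply mul_pos hp0
    rw [sub_pos, div_lt_iff₀ hR0]
    exact hlt
  -- With `j ≈ t * p` and `u ≈ j / R`, the exponent `ρ * j - e * t + e * (t - u)` grows like `t * p
  -- * (ρ - e / R)`; `C` collects the rounding errors of `j` and `u`.
  refine lt_of_forall_two_rpow_le (a := p * (ρ - e / R)) (C := ρ + e * ((p + 1) / R + 1))
    (K := 2 * K) ha ?_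
  have hlarge : ∀ᶠ t : ℕ in Filter.atTop, ((t + 1) * p + 1) / R + 1 ≤ (t : ℝ) := by
    have hk : 0 < 1 - p / R := by rw [sub_pos, div_lt_one hR0]; exact hpR
    filter_upwards [tendsto_natCast_atTop_atTop.eventually_ge_atTop
      (((p + 1) / R + 1) / (1 - p / R))] with t ht
    rw [div_le_iff₀ hk] at ht
    have : ((t + 1) * p + 1) / R = t * (p / R) + (p + 1) / R := by ring
    linarith
  filter_upwards [hlarge] with t ht
  obtain ⟨j, hjt, hj1, hj2, hj3⟩ := exists_binomial_mode hp0 hp1 t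
  -- The first time by which `j + 1` bits have arrived, one more than `j` successes can convey.
  -- Since `p < R`, it is at most `t` for large `t`.
  set u := ⌈((j : ℝ) + 1) / R⌉₊ with hu
  have hu1 : ((j : ℝ) + 1) / R ≤ u := Nat.le_ceil _
  have hu2 : (u : ℝ) < ((j : ℝ) + 1) / R + 1 := Nat.ceil_lt_add_one (by positivity)
  have hu3 : ((j : ℝ) + 1) / R ≤ ((t + 1) * p + 1) / R := by gcongr
  have hut : u ≤ t := by
    have : (u : ℝ) < t := by linarith
    exact_mod_cast this.le
  have hn : j < arrived R u := by
    rw [div_le_iff₀ hR0] at hu1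
    exact Nat.lt_of_succ_le (Nat.le_floor (by exact_mod_cast hu1))
  have hprob := sys.real_successes_lt_le hR t (t - u) (β := β)
    (fun S => (hK S t (t - u) (Nat.sub_le t u)).le)
  rw [Nat.sub_sub_self hut] at hprob
  have hle : (erasureMeasure β).real {ω | successes ω t = j}
      ≤ (erasureMeasure β).real {ω | successes ω t < arrived R u} :=
    measureReal_mono fun ω (hω : _ = _) => (hω.trans_lt hn : successes ω t < _)
  rw [erasureMeasure_real_successes_eq] at hle
  -- Change of measure between the success probabilities `1 - β` and `p`.
  have hterm : (t.choose j : ℝ) * (1 - (β : ℝ)) ^ j * (β : ℝ) ^ (t - j)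
      = (t.choose j * p ^ j * (1 - p) ^ (t - j)) * (2 : ℝ) ^ (ρ * j - e * t) := by
    have h1 : (2 : ℝ) ^ (ρ * j - e * t) = ((2 : ℝ) ^ ρ) ^ j * c ^ t := by
      rw [hce, ← Real.rpow_natCast, ← Real.rpow_natCast, ← Real.rpow_mul (by norm_num),
        ← Real.rpow_mul (by norm_num), ← Real.rpow_add (by norm_num)]
      ring_nf
    have h2 : c ^ t = c ^ j * c ^ (t - j) := by rw [← pow_add, Nat.add_sub_cancel' hjt]
    rw [h1, h2, hqp]
    conv_lhs => rw [hβp]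
    simp only [mul_pow]
    ring
  rw [hterm] at hle
  have hX : 0 < (2 : ℝ) ^ (ρ * j - e * t) := by positivity
  have hmain : (2 : ℝ) ^ (ρ * j - e * t)
      ≤ (t + 1) * (2 * (K * (2 : ℝ) ^ (-(e * ((t - u : ℕ) : ℝ))))) := by
    have ht1 : (0 : ℝ) ≤ t + 1 := by positivity
    calc _ ≤ (t + 1) * (t.choose j * p ^ j * (1 - p) ^ (t - j)) * (2 : ℝ) ^ (ρ * j - e * t) :=
          le_mul_of_one_le_left hX.le hj3
      _ ≤ _ := by
          rw [mul_assoc]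
          exact mul_le_mul_of_nonneg_left (hle.trans hprob) ht1
  rw [Nat.cast_sub hut] at hmain
  have hY : 0 < (2 : ℝ) ^ (e * ((t : ℝ) - u)) := by positivity
  have hexp : (2 : ℝ) ^ (ρ * j - e * t) * (2 : ℝ) ^ (e * ((t : ℝ) - u)) ≤ 2 * K * (t + 1) := by
    have h1 := mul_le_mul_of_nonneg_right hmain hY.le
    have h2 : (2 : ℝ) ^ (-(e * ((t : ℝ) - u))) * (2 : ℝ) ^ (e * ((t : ℝ) - u)) = 1 := by
      rw [← Real.rpow_add (by norm_num)]; simp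
    calc _ ≤ _ := h1
      _ = 2 * K * (t + 1) * ((2 : ℝ) ^ (-(e * ((t : ℝ) - u))) * (2 : ℝ) ^ (e * ((t : ℝ) - u))) := by
        ring
      _ = _ := by rw [h2, mul_one]
  refine le_trans ?_ hexp
  rw [← Real.rpow_add (by norm_num)]
  apply Real.rpow_le_rpow_of_exponent_le (by norm_num)
  have h5 : e * u ≤ e * (((t + 1) * p + 1) / R + 1) :=
    mul_le_mul_of_nonneg_left (by linarith) he0.le
  have h6 : ρ * (t * p - 1) ≤ ρ * j := mul_le_mul_of_nonneg_left hj1 hρ.le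
  have h7 : e * (((t + 1) * p + 1) / R + 1) = p * (e / R) * t + e * ((p + 1) / R + 1) := by ring
  linarith

end Converse

/-! ### The anytime capacity -/

section Capacity

variable {β : unitInterval}

/-- For `α ≤ 0` the bound is at least `2` and hence vacuous, so the capacity is infinite there. -/
lemma System.attains_of_nonpos {ι : Type} {R : ι → ℝ} (sys : System R) (i : ι) {α : ℝ}
    (hα : α ≤ 0) : sys.Attains β i α := by
  refine ⟨2, fun S t d _ => measureReal_le_one.trans_lt ?_⟩
  have : 1 ≤ (2 : ℝ) ^ (-(α * d)) := Real.one_le_rpow (by norm_num)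
    (neg_nonneg.2 (mul_nonpos_of_nonpos_of_nonneg hα (by positivity)))
  linarith

/-- Retransmission of a single stream. -/
noncomputable def retransmission (R : ℝ) : System (fun _ : Unit => R) :=
  (priorityScheme R 0 fun _ _ _ _ => false).restrictHigh

lemma retransmission_attains (hβ : 0 < (β : ℝ)) (hβ1 : (β : ℝ) < 1) {R ρ : ℝ} (hR : 0 ≤ R)
    (hρ : 0 ≤ ρ) (h : ρ * R ≤ gallagerE0 β ρ) : (retransmission R).Attains β () (ρ * R) :=
  (priorityScheme_attains_high _ hβ hβ1 hR hρ h).restrictHigh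

lemma le_anytimeCapacity {R α : ℝ} (hR : 0 ≤ R) {sys : System (fun _ : Unit => R)}
    (h : sys.Attains β () α) : (R : EReal) ≤ anytimeCapacity β α :=
  le_sSup ⟨R, rfl, hR, sys, h⟩

lemma anytimeCapacity_le (hβ : 0 < (β : ℝ)) (hβ1 : (β : ℝ) < 1) {ρ α : ℝ} (hρ : 0 < ρ)
    (hα : gallagerE0 β ρ ≤ α) : anytimeCapacity β α ≤ ((gallagerE0 β ρ / ρ : ℝ) : EReal) := by
  refine sSup_le ?_
  rintro _ ⟨R, rfl, hR, sys, h⟩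
  rw [EReal.coe_le_coe_iff, le_div_iff₀ hρ, mul_comm]
  exact (h.mono hα).mul_le_gallagerE0 hβ hβ1 hR hρ

lemma exists_gt_gallagerE0_lt (hβ : 0 < (β : ℝ)) (hβ1 : (β : ℝ) < 1) {ρ α : ℝ}
    (h : gallagerE0 β ρ < α) : ∃ ρ' > ρ, gallagerE0 β ρ' < α :=
  (((continuous_gallagerE0 hβ hβ1).tendsto ρ).eventually_lt_const h).exists_gt

lemma exists_lt_lt_gallagerE0 (hβ : 0 < (β : ℝ)) (hβ1 : (β : ℝ) < 1) {ρ α : ℝ}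
    (h : α < gallagerE0 β ρ) : ∃ ρ' < ρ, α < gallagerE0 β ρ' :=
  (((continuous_gallagerE0 hβ hβ1).tendsto ρ).eventually_const_lt h).exists_lt

/-- The capacity takes the value `E₀(ρ) / ρ` exactly at the reliability `E₀(ρ)`. -/
lemma anytimeCapacity_eq_iff (hβ : 0 < (β : ℝ)) (hβ1 : (β : ℝ) < 1) {ρ R : ℝ} (hρ : 0 < ρ)
    (hR : R = gallagerE0 β ρ / ρ) (α : ℝ) :
    anytimeCapacity β α = (R : EReal) ↔ α = gallagerE0 β ρ := by
  have hR0 : 0 < R := hR ▸ div_pos (gallagerE0_pos hβ hβ1 hρ) hρ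
  have hρR : ρ * R = gallagerE0 β ρ := by rw [hR]; field_simp
  constructor
  · intro hα
    rcases lt_trichotomy α (gallagerE0 β ρ) with hlt | heq | hgt
    · exfalso
      -- Below `E₀(ρ)` there is room to increase the rate: a slope `ρ' < ρ` with `α < E₀(ρ')`
      -- carries the larger rate `E₀(ρ') / ρ'`.
      suffices ∃ R' > R, (retransmission R').Attains β () α by
        obtain ⟨R', hR', h⟩ := this
        have := le_anytimeCapacity (hR0.trans hR').le h
        rw [hα, EReal.coe_le_coe_iff] at this
        linarith
      rcases le_or_gt α 0 with h0 | h0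
      · exact ⟨R + 1, by linarith, System.attains_of_nonpos _ _ h0⟩
      · obtain ⟨ρ', hρ', hα'⟩ := exists_lt_lt_gallagerE0 hβ hβ1 hlt
        have hρ0 : 0 < ρ' := by
          rw [← (gallagerE0_strictMono hβ hβ1).lt_iff_lt, gallagerE0_zero]
          exact h0.trans hα'
        have hmul : ρ' * (gallagerE0 β ρ' / ρ') = gallagerE0 β ρ' := by field_simp
        refine ⟨gallagerE0 β ρ' / ρ', ?_, ?_⟩
        · rw [hR]
          exact gallagerE0_div_strictAntiOn hβ hβ1 hρ0 hρ hρ'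
        · refine (retransmission_attains hβ hβ1 ?_ hρ0.le hmul.le).mono (hα'.le.trans hmul.ge)
          exact (div_pos (gallagerE0_pos hβ hβ1 hρ0) hρ0).le
    · exact heq
    · exfalso
      obtain ⟨ρ', hρ', hα'⟩ := exists_gt_gallagerE0_lt hβ hβ1 hgt
      have h1 := anytimeCapacity_le hβ hβ1 (hρ.trans hρ') hα'.le
      rw [hα, EReal.coe_le_coe_iff, hR] at h1
      have h2 : gallagerE0 β ρ' / ρ' < gallagerE0 β ρ / ρ :=
        gallagerE0_div_strictAntiOn hβ hβ1 hρ (hρ.trans hρ') hρ'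
      linarith
  · rintro rfl
    refine le_antisymm (hR ▸ anytimeCapacity_le hβ hβ1 hρ le_rfl) ?_
    exact le_anytimeCapacity hR0.le
      ((retransmission_attains hβ hβ1 hR0.le hρ.le hρR.le).mono hρR.ge)

/-- The high-priority stream attains exactly the reliability at which the capacity is its rate. -/
lemma isGreatest_attains_high (hβ : 0 < (β : ℝ)) (hβ1 : (β : ℝ) < 1) {ρ RH RL : ℝ} (hρ : 0 < ρ)
    (hR : RH = gallagerE0 β ρ / ρ)
    (guess : (t : ℕ) → (Fin t → Option Bool) → Stream → ℕ → Bool) :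
    IsGreatest {α : ℝ | (priorityScheme RH RL guess).Attains β .high α} (gallagerE0 β ρ) := by
  have hR0 : 0 < RH := hR ▸ div_pos (gallagerE0_pos hβ hβ1 hρ) hρ
  have hρR : ρ * RH = gallagerE0 β ρ := by rw [hR]; field_simp
  constructor
  · have := priorityScheme_attains_high (RL := RL) guess hβ hβ1 hR0.le hρ.le hρR.le
    rwa [hρR] at this
  · intro α hα
    by_contra! hlt
    obtain ⟨ρ', hρ', hα'⟩ := exists_gt_gallagerE0_lt hβ hβ1 hlt
    have h1 := (System.Attains.mono hα hα'.le).restrictHigh.mul_le_gallagerE0 hβ hβ1 hR0.le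
      (hρ.trans hρ')
    have h2 : gallagerE0 β ρ' / ρ' < gallagerE0 β ρ / ρ :=
      gallagerE0_div_strictAntiOn hβ hβ1 hρ (hρ.trans hρ') hρ'
    rw [← hR, div_lt_iff₀ (hρ.trans hρ'), mul_comm] at h2
    linarith

end Capacity

end Anytime

/-! ### The main theorem. -/

theorem theorem3 (β : unitInterval) (hβ : 0 < (β : ℝ))
    (RH : ℝ) (hRH : 0 < RH) (hRH' : RH < 1 - (β : ℝ)) :
    ∃ αH : ℝ, (∀ α : ℝ, Anytime.anytimeCapacity β α = (RH : EReal) ↔ α = αH) ∧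
      ∃ δ : ℝ, 0 < δ ∧ ∀ RL : ℝ, 0 ≤ RL → RL < 1 - (β : ℝ) - RH →
        ∃ ρHL : ℝ, 0 < ρHL ∧
          (∀ ρ : ℝ, RH + RL = Anytime.gallagerE0 β ρ / ρ ↔ ρ = ρHL) ∧
          ∃ αL : ℝ,
            IsGreatest ((fun ρ => Anytime.gallagerE0 β ρ - ρ * RH) '' Set.Iic ρHL) αL ∧
            (∀ guess, IsGreatest
              {α : ℝ | (Anytime.priorityScheme RH RL guess).Attains β Anytime.Stream.high α} αH) ∧
            (∀ guess,
              (Anytime.priorityScheme RH RL guess).Attains β Anytime.Stream.low αL) ∧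
            (RL < δ → αL = Anytime.binaryDiv (1 - RH) β) := by
  open Anytime in
  have hβ1 : (β : ℝ) < 1 := by linarith
  obtain ⟨ρH, hρH, hH⟩ := exists_eq_gallagerE0_div_iff hβ hβ1 hRH hRH'
  have hRHeq := (hH ρH).2 rfl
  refine ⟨gallagerE0 β ρH, anytimeCapacity_eq_iff hβ hβ1 hρH hRHeq, ?_⟩
  set ρc := criticalSlope β RH
  have hρc : 0 < ρc := criticalSlope_pos hβ hRH hRH'
  -- For `RL` below this `δ`, the total rate is less than `E₀(ρc) / ρc`, which by monotonicity puts
  -- `ρc` below `ρHL`.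
  refine ⟨gallagerE0 β ρc / ρc - RH, ?_, fun RL hRL hRL' => ?_⟩
  · rw [sub_pos, lt_div_iff₀ hρc, mul_comm]
    exact criticalSlope_mul_lt_gallagerE0 hβ hβ1 hRH hRH'
  obtain ⟨ρHL, hρHL, hHL⟩ := exists_eq_gallagerE0_div_iff hβ hβ1 (R := RH + RL)
    (by linarith) (by linarith)
  have hHLeq := (hHL ρHL).2 rfl
  obtain ⟨s, hs0, hs, hmax⟩ := exists_isMaxOn_gallagerE0_sub hβ hβ1 hRH' hρHL
  refine ⟨ρHL, hρHL, hHL, gallagerE0 β s - s * RH, ⟨⟨s, hs, rfl⟩, ?_⟩,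
    isGreatest_attains_high hβ hβ1 hρH hRHeq, fun guess => ?_, fun hδ => ?_⟩
  · rintro _ ⟨ρ, hρ, rfl⟩
    exact hmax ρ hρ
  · refine priorityScheme_attains_low guess hβ hβ1 hRH.le hRL hs0 ?_
    -- Joint stability at the maximizing slope `s ≤ ρHL`: trivial at `s = 0`, otherwise from the
    -- decrease of `E₀(ρ) / ρ`.
    rcases hs0.eq_or_lt with rfl | hs0
    · simp [gallagerE0_zero]
    · have := (gallagerE0_div_strictAntiOn hβ hβ1).antitoneOn hs0 hρHL hs
      change gallagerE0 β ρHL / ρHL ≤ gallagerE0 β s / s at this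
      rwa [← hHLeq, le_div_iff₀ hs0, mul_comm] at this
  · refine le_antisymm (gallagerE0_sub_le_binaryDiv hβ hβ1 hRH (by linarith) s) ?_
    rw [← gallagerE0_sub_criticalSlope hβ hβ1 hRH (by linarith)]
    apply hmax
    refine ((gallagerE0_div_strictAntiOn hβ hβ1).lt_iff_gt hρHL hρc).1 ?_ |>.le
    change gallagerE0 β ρHL / ρHL < gallagerE0 β ρc / ρc
    linarith
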